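/- Let $n\in\mathbb{N}$, let $\eta\in C^1(\mathbb{R}^n)$ be real-valued, let $\{\mathbf{x}_j\}_{j\in J}\subset\mathbb{R}^n$ be a family of nodes and $\{h_j\}_{j\in J}$ a family of positive numbers, and put $$\eta_j(\mathbf{x})=\eta\Big(\frac{\mathbf{x}-\mathbf{x}_j}{h_j}\Big),\qquad j\in J .$$ Assume: 1. there exists $K>0$ such that $$\Big\|\sum_{j}\big(1+h_j^{-1}|\cdot-\mathbf{x}_j|\big)^{-K}\Big\|_{L_\infty(\mathbb{R}^n)}<\infty ;$$ 2. for this $K$ there exists $p>0$ such that $$\big\|(1+|\cdot|)^K e^{p^2|\cdot|^2}\,\eta\big\|_{L_\infty(\mathbb{R}^n)}<\infty ,\qquad \big\|(1+|\cdot|)^K\,\nabla\eta\big\|_{L_\infty(\mathbb{R}^n)}<\infty ;$$ 3. there exists $C\ge 1$ such that $h_j/h_m\le C$ for all indices $j,m$; 4. there exists $c>0$ such that $\sum_j\eta_j(\mathbf{x})\ge c$ for all $\mathbf{x}\in\mathbb{R}^n$. Then for every $\varepsilon>0$ there exist $L_\varepsilon\in\mathbb{N}$ and real polynomials $\mathcal{P}_j$,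 $j\in J$, in $n$ variables, all of total degree $\deg\mathcal{P}_j\le L_\varepsilon$, such that for every $\mathbf{x}\in\mathbb{R}^n$ the series $\sum_j\mathcal{P}_j(\mathbf{x})\,\eta_j(\mathbf{x})$ converges absolutely and $$\Big|\sum_j\mathcal{P}_j(\mathbf{x})\,\eta_j(\mathbf{x})-1\Big|<\varepsilon .$$ -/

import Mathlib

open MeasureTheory

/-- The scaled translate `η_j(y) = η ((y - x_j) / h_j)` of a function `η` on `ℝⁿ`. -/
noncomputable def scaledTranslate {n : ℕ} {ι : Type*} (η : EuclideanSpace ℝ (Fin n) → ℝ)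
    (x : ι → EuclideanSpace ℝ (Fin n)) (h : ι → ℝ) (j : ι) (y : EuclideanSpace ℝ (Fin n)) : ℝ :=
  η ((h j)⁻¹ • (y - x j))

/-- The function `y ↦ ∑_j (1 + |y - x_j| / h_j)^(-K)`, a sum of nonnegative terms with values in
`[0, ∞]`. -/
noncomputable def nodeSum {n : ℕ} {ι : Type*} (x : ι → EuclideanSpace ℝ (Fin n)) (h : ι → ℝ)
    (K : ℝ) (y : EuclideanSpace ℝ (Fin n)) : ENNReal :=
  ∑' j, ENNReal.ofReal ((1 + (h j)⁻¹ * ‖y - x j‖) ^ (-K))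

/-!
Let `σ = ∑ η_j`, so that `σ ≥ c`, and let `Θ = 1 / σ`. Since `∑ Θ η_j = 1`, it suffices to find
polynomials `P_j` of bounded degree with `|P_j - Θ| |η_j|` at most a small multiple of
`(1 + |y - x_j| / h_j)^(-K)`, because these majorants have bounded sums. As `η_j` carries the factor
`exp (-p² |u|²)` in the rescaled variable `u = (y - x_j) / h_j`, this amounts to approximating each
function `f_j u = Θ (x_j + h_j u)` by a polynomial in the supremum norm with weight
`exp (-p² |u|²)`, with a degree that does not depend on `j`.

The `f_j` are bounded by `1 / c`, and the gradient bound together with `h_j / h_m ≤ C` makes them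
equicontinuous. On a large ball they are therefore close to combinations, with coefficients of
modulus at most `1 / c`, of finitely many functions of one partition of unity, and outside the ball
the weight is small. Approximating these finitely many functions gives the common degree
(`exists_degree_forall_gaussian_approx`).

What remains is that polynomials are dense in the bounded continuous functions for each Gaussian
weight (`gaussianApproximable_of_bounded`). The bounded continuous functions that are limits of
polynomials for *all* Gaussian weights form an algebra, since a weight is a product of two weaker
ones. The algebra contains the functions `sin (a y_i)`, whose Taylor series converge in the weighted
norms, and these separate points. By the Stone–Weierstrass theorem it is dense on balls, and
composing with a polynomial that imitates truncation keeps the approximants bounded off the ball.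
-/

/-! ### Polynomial approximation with Gaussian weights -/

section

/-- The tail of the exponential series from order `n` on is at most `2⁻ⁿ` times the same tail at
`2 ‖z‖`. -/
theorem Complex.norm_exp_sub_sum_le_two_pow (z : ℂ) (n : ℕ) :
    ‖Complex.exp z - ∑ m ∈ Finset.range n, z ^ m / m.factorial‖
      ≤ (1 / 2) ^ n * Real.exp (2 * ‖z‖) := by
  have hz : HasSum (fun m : ℕ => z ^ m / m.factorial) (Complex.exp z) := by
    rw [Complex.exp_eq_exp_ℂ]
    exact NormedSpace.expSeries_div_hasSum_exp z
  have hr : HasSum (fun m : ℕ => (2 * ‖z‖) ^ m / m.factorial) (Real.exp (2 * ‖z‖)) := by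
    rw [Real.exp_eq_exp_ℝ]
    exact NormedSpace.expSeries_div_hasSum_exp (2 * ‖z‖)
  have htail := (hasSum_nat_add_iff' n).2 hz
  have hrtail := (summable_nat_add_iff n).2 hr.summable
  rw [← htail.tsum_eq]
  have hle : ∀ m : ℕ, ‖z ^ (m + n) / (m + n).factorial‖
      ≤ (1 / 2) ^ n * ((2 * ‖z‖) ^ (m + n) / (m + n).factorial) := by
    intro m
    rw [norm_div, norm_pow, Complex.norm_natCast, ← mul_div_assoc]
    gcongr
    rw [mul_pow, ← mul_assoc]
    refine le_mul_of_one_le_left (by positivity) ?_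
    rw [pow_add, mul_comm, mul_assoc, ← mul_pow]
    norm_num
    exact one_le_pow₀ (by norm_num)
  refine (tsum_of_norm_bounded (hrtail.hasSum.mul_left _) hle).trans ?_
  gcongr
  rw [← hr.tsum_eq, ← hr.summable.sum_add_tsum_nat_add n]
  exact le_add_of_nonneg_left (Finset.sum_nonneg fun _ _ => by positivity)

/-- The weight `exp (-s |y|²)` on `ℝⁿ`. -/
noncomputable def gaussianWeight {n : ℕ} (s : ℝ) (y : EuclideanSpace ℝ (Fin n)) : ℝ :=
  Real.exp (-(s * ‖y‖ ^ 2))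

/-- `F` is a limit of polynomials in the supremum norm with weight `exp (-s |y|²)`. -/
def GaussianApproximable {n : ℕ} (s : ℝ) (F : EuclideanSpace ℝ (Fin n) → ℝ) : Prop :=
  ∀ δ : ℝ, 0 < δ → ∃ P : MvPolynomial (Fin n) ℝ, ∀ y : EuclideanSpace ℝ (Fin n),
    |F y - MvPolynomial.eval (fun i => y i) P| * gaussianWeight s y ≤ δ

variable {n : ℕ}

local notation "E" => EuclideanSpace ℝ (Fin n)

theorem gaussianWeight_pos (s : ℝ) (y : E) : 0 < gaussianWeight s y := Real.exp_pos _

theorem gaussianWeight_le_one {s : ℝ} (hs : 0 ≤ s) (y : E) : gaussianWeight s y ≤ 1 :=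
  Real.exp_le_one_iff.2 (neg_nonpos.2 (by positivity))

theorem gaussianWeight_half_mul_half (s : ℝ) (y : E) :
    gaussianWeight (s / 2) y * gaussianWeight (s / 2) y = gaussianWeight s y := by
  rw [gaussianWeight, gaussianWeight, ← Real.exp_add]
  congr 1
  ring

theorem exists_gaussianWeight_mul_le {s δ : ℝ} (hs : 0 < s) (hδ : 0 < δ) (B : ℝ) :
    ∃ R : ℝ, ∀ y : E, R < ‖y‖ → B * gaussianWeight s y ≤ δ := by
  have h : Filter.Tendsto (fun t : ℝ => B * Real.exp (-(s * t ^ 2))) Filter.atTop (nhds (B * 0)) :=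
    ((Real.tendsto_exp_neg_atTop_nhds_zero.comp
      ((Filter.tendsto_pow_atTop two_ne_zero).const_mul_atTop hs))).const_mul B
  rw [mul_zero] at h
  obtain ⟨R, hR⟩ := Filter.eventually_atTop.1 (h.eventually_le_const hδ)
  exact ⟨R, fun y hy => hR _ hy.le⟩

theorem gaussianApproximable_eval (s : ℝ) (P : MvPolynomial (Fin n) ℝ) :
    GaussianApproximable s fun y : E => MvPolynomial.eval (fun i => y i) P :=
  fun δ hδ => ⟨P, fun y => by simpa using hδ.le⟩

theorem GaussianApproximable.add {s : ℝ} {F G : E → ℝ} (hF : GaussianApproximable s F)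
    (hG : GaussianApproximable s G) : GaussianApproximable s fun y => F y + G y := by
  intro δ hδ
  obtain ⟨P, hP⟩ := hF (δ / 2) (half_pos hδ)
  obtain ⟨Q, hQ⟩ := hG (δ / 2) (half_pos hδ)
  refine ⟨P + Q, fun y => ?_⟩
  calc _ ≤ (|F y - MvPolynomial.eval (fun i => y i) P|
        + |G y - MvPolynomial.eval (fun i => y i) Q|) * gaussianWeight s y := by
        gcongr
        · exact (gaussianWeight_pos s y).le
        · rw [map_add, add_sub_add_comm]
          exact abs_add_le _ _
    _ ≤ δ := by rw [add_mul]; linarith [hP y, hQ y]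

/-- Products are approximable because the weight splits into two weights of half the exponent. -/
theorem GaussianApproximable.mul {s B B' : ℝ} (hs : 0 ≤ s) {F G : E → ℝ}
    (hF : GaussianApproximable (s / 2) F) (hG : GaussianApproximable (s / 2) G)
    (hFB : ∀ y, |F y| ≤ B) (hGB : ∀ y, |G y| ≤ B') :
    GaussianApproximable s fun y => F y * G y := by
  intro δ hδ
  have hB : 0 ≤ B := (abs_nonneg _).trans (hFB 0)
  have hB' : 0 ≤ B' := (abs_nonneg _).trans (hGB 0)
  -- The bound by one makes the weighted size of `P` at most `B + 1`, before `Q` is chosen.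
  obtain ⟨P, hP⟩ := hF (min 1 (δ / (2 * (B' + 1)))) (by positivity)
  obtain ⟨Q, hQ⟩ := hG (δ / (2 * (B + 1))) (by positivity)
  refine ⟨P * Q, fun y => ?_⟩
  set w := gaussianWeight (s / 2) y with hw
  have hw0 : 0 < w := gaussianWeight_pos _ y
  have hw1 : w ≤ 1 := gaussianWeight_le_one (by positivity) y
  set a := MvPolynomial.eval (fun i => y i) P
  set b := MvPolynomial.eval (fun i => y i) Q
  have h1 : |F y - a| * w ≤ 1 := (hP y).trans (min_le_left _ _)
  have h2 : |F y - a| * w ≤ δ / (2 * (B' + 1)) := (hP y).trans (min_le_right _ _)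
  have h3 : |G y - b| * w ≤ δ / (2 * (B + 1)) := hQ y
  have ha : |a| * w ≤ B + 1 := by
    have : |a| ≤ |F y| + |F y - a| := by
      have := abs_sub (F y) (F y - a)
      rwa [sub_sub_cancel] at this
    calc |a| * w ≤ (|F y| + |F y - a|) * w := by gcongr
      _ ≤ B * 1 + 1 := by
        rw [add_mul]
        gcongr
        exact hFB y
      _ = B + 1 := by ring
  have hGw : |G y| * w ≤ B' + 1 := by
    calc |G y| * w ≤ B' * 1 := by gcongr; exact hGB y
      _ ≤ B' + 1 := by linarith
  calc _ = |(F y - a) * G y + a * (G y - b)| * (w * w) := by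
        rw [map_mul, hw, gaussianWeight_half_mul_half]
        congr 2
        ring
    _ ≤ (|F y - a| * |G y| + |a| * |G y - b|) * (w * w) := by
        gcongr
        exact (abs_add_le _ _).trans_eq (by rw [abs_mul, abs_mul])
    _ = (|F y - a| * w) * (|G y| * w) + (|a| * w) * (|G y - b| * w) := by ring
    _ ≤ (δ / (2 * (B' + 1))) * (B' + 1) + (B + 1) * (δ / (2 * (B + 1))) := by gcongr
    _ = δ := by field_simp; norm_num

/-- The bounded continuous functions that are limits of polynomials for every Gaussian weight.
Quantifying over all weights is what makes this set closed under multiplication. -/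
noncomputable def gaussianSubalgebra (n : ℕ) :
    Subalgebra ℝ (BoundedContinuousFunction (EuclideanSpace ℝ (Fin n)) ℝ) where
  carrier := {F | ∀ s : ℝ, 0 < s → GaussianApproximable s F}
  mul_mem' {F G} hF hG s hs :=
    (hF (s / 2) (half_pos hs)).mul hs.le (hG (s / 2) (half_pos hs))
      F.norm_coe_le_norm G.norm_coe_le_norm
  add_mem' hF hG s hs := (hF s hs).add (hG s hs)
  algebraMap_mem' r s _ := by
    simpa using! gaussianApproximable_eval s (MvPolynomial.C r)

/-- The Taylor polynomials of the sine converge in the weighted norm: the remainder of order `m` is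
at most `2⁻ᵐ exp (2 |a t|)`, and `2 |a t| ≤ s t² + a² / s`. -/
theorem gaussianApproximable_sin {s : ℝ} (hs : 0 < s) (a : ℝ) (i : Fin n) :
    GaussianApproximable s fun y : E => Real.sin (a * y i) := by
  intro δ hδ
  obtain ⟨m, hm⟩ := exists_pow_lt_of_lt_one (show 0 < δ / Real.exp (a ^ 2 / s) by positivity)
    (show (1 / 2 : ℝ) < 1 by norm_num)
  refine ⟨∑ k ∈ Finset.range m, MvPolynomial.C ((Complex.I ^ k).im * a ^ k / k.factorial)
    * MvPolynomial.X i ^ k, fun y => ?_⟩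
  set z : ℂ := ((a * y i : ℝ) : ℂ) * Complex.I with hz
  have him : Real.sin (a * y i) - MvPolynomial.eval (fun i => y i)
      (∑ k ∈ Finset.range m, MvPolynomial.C ((Complex.I ^ k).im * a ^ k / k.factorial)
        * MvPolynomial.X i ^ k)
      = (Complex.exp z - ∑ k ∈ Finset.range m, z ^ k / k.factorial).im := by
    rw [Complex.sub_im, Complex.im_sum, hz, Complex.exp_ofReal_mul_I_im, map_sum]
    congr 1
    refine Finset.sum_congr rfl fun k _ => ?_
    have : (((a * y i : ℝ) : ℂ) * Complex.I) ^ k / k.factorial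
        = (((a * y i) ^ k / k.factorial : ℝ) : ℂ) * Complex.I ^ k := by
      push_cast
      ring
    rw [this, Complex.im_ofReal_mul]
    simp
    ring
  rw [him]
  have hnorm : ‖z‖ = |a| * |y i| := by simp [hz]
  have hyi : |y i| ≤ ‖y‖ := by simpa using PiLp.norm_apply_le y i
  have hexp : 2 * ‖z‖ ≤ a ^ 2 / s + s * ‖y‖ ^ 2 := by
    have h1 : 2 * (|a| * ‖y‖) ≤ a ^ 2 / s + s * ‖y‖ ^ 2 := by
      have h2 : 0 ≤ (|a| - s * ‖y‖) ^ 2 / s := by positivity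
      have h3 : (|a| - s * ‖y‖) ^ 2 / s = a ^ 2 / s - 2 * (|a| * ‖y‖) + s * ‖y‖ ^ 2 := by
        rw [← sq_abs a]
        field_simp
        ring
      linarith
    rw [hnorm]
    exact le_trans (by gcongr) h1
  calc _ ≤ ((1 / 2) ^ m * Real.exp (a ^ 2 / s + s * ‖y‖ ^ 2)) * gaussianWeight s y := by
        gcongr
        · exact (gaussianWeight_pos s y).le
        · exact (Complex.abs_im_le_norm _).trans
            ((Complex.norm_exp_sub_sum_le_two_pow z m).trans (by gcongr))
    _ = (1 / 2) ^ m * Real.exp (a ^ 2 / s) := by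
        rw [mul_assoc, gaussianWeight, ← Real.exp_add]
        congr 2
        ring
    _ ≤ δ := ((lt_div_iff₀ (Real.exp_pos _)).1 hm).le

/-- The bounded continuous function `y ↦ sin (a y_i)`. -/
noncomputable def sinCoord (a : ℝ) (i : Fin n) : BoundedContinuousFunction E ℝ :=
  BoundedContinuousFunction.ofNormedAddCommGroup (fun y : E => Real.sin (a * y i))
    (by fun_prop) 1 fun y => by simpa using Real.abs_sin_le_one _

theorem sinCoord_mem (a : ℝ) (i : Fin n) : sinCoord a i ∈ gaussianSubalgebra n :=
  fun _ hs => gaussianApproximable_sin hs a i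

theorem gaussianSubalgebra_separatesPoints :
    ((gaussianSubalgebra n).map
      (BoundedContinuousFunction.toContinuousMapₐ ℝ)).SeparatesPoints := by
  intro y z hyz
  obtain ⟨i, hi⟩ : ∃ i, y i ≠ z i := by
    by_contra! h
    exact hyz (PiLp.ext h)
  -- With this frequency both arguments of the sine lie in `[-1, 1]`, where the sine is injective.
  set M : ℝ := |y i| + |z i| + 1 with hM
  have hM0 : 0 < M := by positivity
  have hmem : ∀ t : ℝ, |t| ≤ M → M⁻¹ * t ∈ Set.Icc (-(Real.pi / 2)) (Real.pi / 2) := by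
    intro t ht
    have h1 : |M⁻¹ * t| ≤ 1 := by
      rw [abs_mul, abs_of_pos (inv_pos.2 hM0), inv_mul_le_iff₀ hM0, mul_one]
      exact ht
    have h2 := abs_le.1 h1
    have := Real.pi_gt_three
    constructor <;> linarith [h2.1, h2.2]
  refine ⟨_, ⟨_, ⟨sinCoord M⁻¹ i, sinCoord_mem _ i, rfl⟩, rfl⟩, fun h => hi ?_⟩
  have := Real.injOn_sin (hmem (y i) (by linarith [abs_nonneg (z i)]))
    (hmem (z i) (by linarith [abs_nonneg (y i)])) h
  exact mul_left_cancel₀ (inv_ne_zero hM0.ne') this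

/-- A bounded continuous function is approximated on a ball by an element `g` of the subalgebra;
composing `g` with a polynomial close to the truncation at height `‖f‖` on the range of `g` keeps
the approximation on the ball and makes it bounded by `‖f‖ + δ` everywhere. -/
theorem exists_mem_gaussianSubalgebra_near (f : BoundedContinuousFunction E ℝ) (R : ℝ)
    {δ : ℝ} (hδ : 0 < δ) :
    ∃ g ∈ gaussianSubalgebra n, (∀ y : E, |g y| ≤ ‖f‖ + δ) ∧
      ∀ y : E, ‖y‖ ≤ R → |g y - f y| ≤ 2 * δ := by
  obtain ⟨_, ⟨g, hg, rfl⟩, hgf⟩ :=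
    ContinuousMap.exists_mem_subalgebra_near_continuous_of_isCompact_of_separatesPoints
      (gaussianSubalgebra_separatesPoints (n := n)) f.toContinuousMap
      (isCompact_closedBall (0 : E) R) hδ
  have hB : -‖f‖ ≤ ‖f‖ := by linarith [norm_nonneg f]
  set T : ℝ → ℝ := fun t => (Set.projIcc (-‖f‖) ‖f‖ hB t : ℝ) with hT
  obtain ⟨q, hq⟩ := exists_polynomial_near_of_continuousOn (-‖g‖) ‖g‖ T
    (continuous_subtype_val.comp continuous_projIcc).continuousOn δ hδ
  have hval : ∀ y, (Polynomial.aeval g q) y = q.eval (g y) := by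
    clear hq
    intro y
    induction q using Polynomial.induction_on' with
    | add p q hp hq => simp_all
    | monomial k a => simp [Polynomial.aeval_monomial]
  have hrange : ∀ y, g y ∈ Set.Icc (-‖g‖) ‖g‖ := fun y => abs_le.1 (g.norm_coe_le_norm y)
  refine ⟨Polynomial.aeval g q, ?_, fun y => ?_, fun y hy => ?_⟩
  · have hmem := (Polynomial.aeval (⟨g, hg⟩ : gaussianSubalgebra n) q).2
    rwa [Polynomial.coe_aeval_mk_apply] at hmem
  · rw [hval]
    have h1 := hq _ (hrange y)
    have h2 : |T (g y)| ≤ ‖f‖ := abs_le.2 (Set.projIcc (-‖f‖) ‖f‖ hB (g y)).2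
    have h3 := abs_sub_abs_le_abs_sub (q.eval (g y)) (T (g y))
    linarith
  · rw [hval]
    have h1 := hq _ (hrange y)
    have h2 : T (f y) = f y := by
      rw [hT]
      dsimp only
      rw [Set.projIcc_of_mem hB (abs_le.1 (f.norm_coe_le_norm y))]
    have h3 : |T (g y) - T (f y)| ≤ |g y - f y| := Set.abs_projIcc_sub_projIcc hB
    have h4 : |g y - f y| < δ := hgf y (by simpa using hy)
    have h5 := abs_sub_le (q.eval (g y)) (T (g y)) (f y)
    rw [h2] at h3
    linarith

/-- Polynomials are dense in the bounded continuous functions for every Gaussian weight. -/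
theorem gaussianApproximable_of_bounded (f : BoundedContinuousFunction E ℝ) {s : ℝ} (hs : 0 < s) :
    GaussianApproximable s f := by
  intro δ hδ
  obtain ⟨R, hR⟩ := exists_gaussianWeight_mul_le (n := n) hs (half_pos hδ) (2 * ‖f‖ + δ / 4)
  obtain ⟨g, hg, hgb, hgf⟩ := exists_mem_gaussianSubalgebra_near f R (show 0 < δ / 4 by positivity)
  obtain ⟨P, hP⟩ := hg s hs (δ / 2) (half_pos hδ)
  refine ⟨P, fun y => ?_⟩
  have hw := gaussianWeight_pos s y
  have key : |g y - f y| * gaussianWeight s y ≤ δ / 2 := by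
    rcases le_or_gt ‖y‖ R with hy | hy
    · calc _ ≤ (2 * (δ / 4)) * 1 := by
            gcongr
            · exact hgf y hy
            · exact gaussianWeight_le_one hs.le y
        _ = δ / 2 := by ring
    · refine le_trans ?_ (hR y hy)
      gcongr
      have h1 := abs_sub (g y) (f y)
      have h2 : |f y| ≤ ‖f‖ := f.norm_coe_le_norm y
      linarith [hgb y]
  calc _ ≤ (|f y - g y| + |g y - MvPolynomial.eval (fun i => y i) P|) * gaussianWeight s y := by
        gcongr
        exact abs_sub_le _ _ _
    _ ≤ δ := by
        rw [add_mul, abs_sub_comm (f y)]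
        linarith [hP y]

/-- For a uniformly bounded and equicontinuous family, polynomials of one common degree suffice:
on a large ball each function is nearly a combination, with bounded coefficients, of finitely many
fixed functions of a partition of unity. -/
theorem exists_degree_forall_gaussian_approx {s B δ r : ℝ} (hs : 0 < s) (hB : 0 < B) (hδ : 0 < δ)
    (hr : 0 < r) :
    ∃ L : ℕ, ∀ f : E → ℝ, (∀ y, |f y| ≤ B) → (∀ u v, ‖u - v‖ < r → |f u - f v| ≤ δ) →
      ∃ P : MvPolynomial (Fin n) ℝ, P.totalDegree ≤ L ∧
        ∀ y : E, |f y - MvPolynomial.eval (fun i => y i) P| * gaussianWeight s y ≤ 2 * δ := by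
  obtain ⟨R, hR⟩ := exists_gaussianWeight_mul_le (n := n) hs hδ (2 * B)
  obtain ⟨t, -, htfin, ht⟩ := (isCompact_closedBall (0 : E) R).finite_cover_balls hr
  have := htfin.fintype
  obtain ⟨ρ, hρ⟩ := PartitionOfUnity.exists_isSubordinate (Metric.isClosed_closedBall)
    (fun a : t => Metric.ball (a : E) r) (fun _ => Metric.isOpen_ball)
    (ht.trans (Set.biUnion_eq_iUnion t fun a _ => Metric.ball a r).subset)
  have hρ0 : ∀ a y, a ∈ Finset.univ → 0 ≤ ρ a y := fun a y _ => ρ.nonneg a y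
  have hρ1 : ∀ y, ∑ a, ρ a y ≤ 1 := fun y => by
    rw [← finsum_eq_sum_of_fintype]
    exact ρ.sum_le_one y
  set N : ℝ := Fintype.card t + 1 with hN
  have hN0 : 0 < N := by positivity
  have happ : ∀ a : t, ∃ Q : MvPolynomial (Fin n) ℝ, ∀ y : E,
      |ρ a y - MvPolynomial.eval (fun i => y i) Q| * gaussianWeight s y ≤ δ / (B * N) := by
    intro a
    refine gaussianApproximable_of_bounded (BoundedContinuousFunction.ofNormedAddCommGroup (ρ a)
      (ρ a).continuous 1 fun y => ?_) hs _ (by positivity)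
    rw [Real.norm_of_nonneg (ρ.nonneg a y)]
    exact ρ.le_one a y
  choose Q hQ using happ
  refine ⟨Finset.univ.sup fun a => (Q a).totalDegree, fun f hf hfr =>
    ⟨∑ a : t, MvPolynomial.C (f a) * Q a, ?_, fun y => ?_⟩⟩
  · refine (MvPolynomial.totalDegree_finsetSum _ _).trans (Finset.sup_mono_fun fun a _ => ?_)
    refine (MvPolynomial.totalDegree_mul _ _).trans ?_
    rw [MvPolynomial.totalDegree_C, zero_add]
  have hw := gaussianWeight_pos s y
  have hsum : |∑ a, ρ a y * f a| ≤ B := by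
    calc _ ≤ ∑ a, ρ a y * B := by
          refine (Finset.abs_sum_le_sum_abs _ _).trans (Finset.sum_le_sum fun a ha => ?_)
          rw [abs_mul, abs_of_nonneg (hρ0 a y ha)]
          exact mul_le_mul_of_nonneg_left (hf a) (hρ0 a y ha)
      _ ≤ B := by
          rw [← Finset.sum_mul]
          exact mul_le_of_le_one_left hB.le (hρ1 y)
  have h1 : |f y - ∑ a, ρ a y * f a| * gaussianWeight s y ≤ δ := by
    rcases le_or_gt ‖y‖ R with hy | hy
    · have hone : ∑ a, ρ a y = 1 := by
        rw [← finsum_eq_sum_of_fintype]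
        exact ρ.sum_eq_one (by simpa using hy)
      have : |f y - ∑ a, ρ a y * f a| ≤ δ := by
        calc _ = |∑ a, ρ a y * (f y - f a)| := by
              simp_rw [mul_sub]
              rw [Finset.sum_sub_distrib, ← Finset.sum_mul, hone, one_mul]
          _ ≤ ∑ a, ρ a y * δ := by
              refine (Finset.abs_sum_le_sum_abs _ _).trans (Finset.sum_le_sum fun a ha => ?_)
              rw [abs_mul, abs_of_nonneg (hρ0 a y ha)]
              by_cases hay : ρ a y = 0
              · simp [hay]
              refine mul_le_mul_of_nonneg_left (hfr _ _ ?_) (hρ0 a y ha)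
              have := hρ a (subset_tsupport _ hay)
              rwa [Metric.mem_ball, dist_eq_norm] at this
          _ = δ := by rw [← Finset.sum_mul, hone, one_mul]
      calc _ ≤ δ * 1 := by
            gcongr
            exact gaussianWeight_le_one hs.le y
        _ = δ := mul_one δ
    · refine le_trans ?_ (hR y hy)
      gcongr
      have := abs_sub (f y) (∑ a, ρ a y * f a)
      linarith [hf y]
  have h2 : |∑ a, ρ a y * f a - MvPolynomial.eval (fun i => y i)
      (∑ a : t, MvPolynomial.C (f a) * Q a)| * gaussianWeight s y ≤ δ := by
    rw [map_sum, ← Finset.sum_sub_distrib]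
    calc _ ≤ (∑ a, |ρ a y * f a - MvPolynomial.eval (fun i => y i)
            (MvPolynomial.C (f a) * Q a)|) * gaussianWeight s y := by
          gcongr
          exact Finset.abs_sum_le_sum_abs _ _
      _ ≤ ∑ _a : t, B * (δ / (B * N)) := by
          rw [Finset.sum_mul]
          refine Finset.sum_le_sum fun a _ => ?_
          rw [map_mul, MvPolynomial.eval_C, mul_comm (f a), ← sub_mul, abs_mul, mul_comm _ |f a|,
            mul_assoc]
          gcongr
          · exact hf a
          · exact hQ a y
      _ = δ * (Fintype.card t / N) := by
          rw [Finset.sum_const, Finset.card_univ, nsmul_eq_mul]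
          field_simp
      _ ≤ δ := mul_le_of_le_one_right hδ.le ((div_le_one hN0).2 (by rw [hN]; linarith))
  calc _ ≤ (|f y - ∑ a, ρ a y * f a| + |∑ a, ρ a y * f a - MvPolynomial.eval (fun i => y i)
          (∑ a : t, MvPolynomial.C (f a) * Q a)|) * gaussianWeight s y := by
        gcongr
        exact abs_sub_le _ _ _
    _ ≤ 2 * δ := by
        rw [add_mul]
        linarith

/-- Substituting `h⁻¹ (y - x)` for the variables does not raise the total degree. -/
theorem exists_totalDegree_le_eval_affine (P : MvPolynomial (Fin n) ℝ) (x : E) (h : ℝ) :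
    ∃ Q : MvPolynomial (Fin n) ℝ, Q.totalDegree ≤ P.totalDegree ∧ ∀ y : E,
      MvPolynomial.eval (fun i => y i) Q
        = MvPolynomial.eval (fun i => (h⁻¹ • (y - x)) i) P := by
  set σ : Fin n → MvPolynomial (Fin n) ℝ :=
    fun i => MvPolynomial.C h⁻¹ * (MvPolynomial.X i - MvPolynomial.C (x i)) with hσ
  have hdeg : ∀ i, (σ i).totalDegree ≤ 1 := by
    intro i
    refine (MvPolynomial.totalDegree_mul _ _).trans ?_
    rw [MvPolynomial.totalDegree_C, zero_add]
    refine (MvPolynomial.totalDegree_sub _ _).trans ?_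
    simp
  refine ⟨MvPolynomial.bind₁ σ P, ?_, fun y => ?_⟩
  · rw [MvPolynomial.bind₁, MvPolynomial.aeval_def, MvPolynomial.eval₂_eq]
    refine MvPolynomial.totalDegree_finsetSum_le fun d hd => ?_
    refine (MvPolynomial.totalDegree_mul _ _).trans ?_
    rw [MvPolynomial.algebraMap_eq, MvPolynomial.totalDegree_C, zero_add]
    refine (MvPolynomial.totalDegree_finsetProd _ _).trans
      (le_trans ?_ (MvPolynomial.le_totalDegree hd))
    refine Finset.sum_le_sum fun i _ => (MvPolynomial.totalDegree_pow _ _).trans ?_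
    exact mul_le_of_le_one_right (Nat.zero_le _) (hdeg i)
  · rw [← MvPolynomial.aeval_eq_eval, ← MvPolynomial.aeval_eq_eval, MvPolynomial.aeval_bind₁]
    simp [hσ]

/-! ### Bounds on the generating function and on the nodes -/

/-- An essential bound on a continuous function holds everywhere, since it holds on a closed dense
set. -/
theorem Continuous.exists_norm_le_of_eLpNorm_top_lt {X F : Type*} [TopologicalSpace X]
    [MeasurableSpace X] {μ : Measure X} [μ.IsOpenPosMeasure]
    [NormedAddCommGroup F] {g : X → F} (hg : Continuous g) (h : eLpNorm g ⊤ μ < ⊤) :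
    ∃ B : ℝ, 0 < B ∧ ∀ y, ‖g y‖ ≤ B := by
  refine ⟨(eLpNorm g ⊤ μ).toReal + 1, by positivity, fun y => ?_⟩
  have hae : ∀ᵐ y ∂μ, ‖g y‖ ≤ (eLpNorm g ⊤ μ).toReal := by
    rw [eLpNorm_exponent_top] at h ⊢
    filter_upwards [ae_le_eLpNormEssSup (f := g) (μ := μ)] with y hy
    rw [← toReal_enorm]
    exact ENNReal.toReal_mono h.ne hy
  have hclosed : IsClosed {y | ‖g y‖ ≤ (eLpNorm g ⊤ μ).toReal} :=
    isClosed_le hg.norm continuous_const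
  have : y ∈ closure {y | ‖g y‖ ≤ (eLpNorm g ⊤ μ).toReal} := Measure.dense_of_ae hae y
  rw [hclosed.closure_eq] at this
  exact (Set.mem_ofPred_eq ▸ this).trans (by linarith)

/-- The function `y ↦ (1 + |y - x| / h)^(-K)`, the profile that dominates a scaled translate. -/
noncomputable def nodeTerm (x : E) (h K : ℝ) (y : E) : ℝ := (1 + h⁻¹ * ‖y - x‖) ^ (-K)

theorem nodeTerm_nonneg {x : E} {h : ℝ} (hh : 0 < h) (K : ℝ) (y : E) : 0 ≤ nodeTerm x h K y := by
  unfold nodeTerm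
  positivity

theorem continuous_nodeTerm {x : E} {h : ℝ} (hh : 0 < h) (K : ℝ) :
    Continuous (nodeTerm x h K) := by
  unfold nodeTerm
  refine Continuous.rpow_const (by fun_prop) fun y => Or.inl ?_
  positivity

/-- The essential bound on the node sum holds at every point: finite partial sums are continuous. -/
theorem exists_sum_nodeTerm_le {ι : Type*} {x : ι → E} {h : ι → ℝ} (hh : ∀ j, 0 < h j) {K : ℝ}
    (hnodes : eLpNorm (nodeSum x h K) ⊤ volume < ⊤) :
    ∃ M : ℝ, 0 < M ∧ ∀ y, Summable (fun j => nodeTerm (x j) (h j) K y) ∧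
      ∑' j, nodeTerm (x j) (h j) K y ≤ M := by
  set T := eLpNorm (nodeSum x h K) ⊤ volume with hT
  have hae : ∀ᵐ y, nodeSum x h K y ≤ T := by
    rw [hT, eLpNorm_exponent_top]
    exact ae_le_eLpNormEssSup
  have hfin : ∀ (y : E) (t : Finset ι), ∑ j ∈ t, nodeTerm (x j) (h j) K y ≤ T.toReal + 1 := by
    intro y t
    have hclosed : IsClosed {y | ∑ j ∈ t, nodeTerm (x j) (h j) K y ≤ T.toReal} :=
      isClosed_le (continuous_finsetSum _ fun j _ => continuous_nodeTerm (hh j) K)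
        continuous_const
    have hae' : ∀ᵐ y, ∑ j ∈ t, nodeTerm (x j) (h j) K y ≤ T.toReal := by
      filter_upwards [hae] with y hy
      rw [← ENNReal.ofReal_le_iff_le_toReal hnodes.ne,
        ENNReal.ofReal_sum_of_nonneg fun j _ => nodeTerm_nonneg (hh j) K y]
      exact (ENNReal.sum_le_tsum t).trans hy
    have : y ∈ closure {y | ∑ j ∈ t, nodeTerm (x j) (h j) K y ≤ T.toReal} :=
      Measure.dense_of_ae hae' y
    rw [hclosed.closure_eq] at this
    exact (Set.mem_ofPred_eq ▸ this).trans (by linarith)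
  refine ⟨T.toReal + 1, by positivity, fun y => ⟨?_, ?_⟩⟩
  · exact summable_of_sum_le (fun j => nodeTerm_nonneg (hh j) K y) (hfin y)
  · exact Real.tsum_le_of_sum_le (fun j => nodeTerm_nonneg (hh j) K y) (hfin y)

theorem exists_abs_le_of_decay {η : E → ℝ} (hη : Continuous η) {K p : ℝ}
    (hdecay : eLpNorm (fun y => (1 + ‖y‖) ^ K * Real.exp (p ^ 2 * ‖y‖ ^ 2) * η y) ⊤ volume < ⊤) :
    ∃ A : ℝ, 0 < A ∧ ∀ u, |η u| ≤ A * (1 + ‖u‖) ^ (-K) * gaussianWeight (p ^ 2) u := by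
  have hcont : Continuous fun y : E => (1 + ‖y‖) ^ K :=
    Continuous.rpow_const (by fun_prop) fun y => Or.inl (by positivity)
  obtain ⟨A, hA, hb⟩ := Continuous.exists_norm_le_of_eLpNorm_top_lt
    ((hcont.mul (by fun_prop)).mul hη) hdecay
  refine ⟨A, hA, fun u => ?_⟩
  have h1 : ‖(1 + ‖u‖) ^ K * Real.exp (p ^ 2 * ‖u‖ ^ 2) * η u‖ ≤ A := hb u
  rw [norm_mul, Real.norm_of_nonneg (by positivity), Real.norm_eq_abs] at h1
  rw [gaussianWeight, Real.exp_neg, Real.rpow_neg (by positivity), mul_assoc, ← mul_inv,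
    ← div_eq_mul_inv, le_div_iff₀ (by positivity)]
  linarith

/-- Within distance one of `u` the gradient is dominated by its decay bound at `u`, at the price of
a factor `2 ^ K`. -/
theorem exists_abs_sub_le_of_gradient_decay {η : E → ℝ} (hη : ContDiff ℝ 1 η) {K : ℝ} (hK : 0 < K)
    (hgrad : eLpNorm (fun y => (1 + ‖y‖) ^ K • gradient η y) ⊤ volume < ⊤) :
    ∃ D : ℝ, 0 < D ∧ ∀ u v : E, ‖v - u‖ ≤ 1 → |η v - η u| ≤ D * ‖v - u‖ * (1 + ‖u‖) ^ (-K) := by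
  have hcont : Continuous fun y : E => (1 + ‖y‖) ^ K :=
    Continuous.rpow_const (by fun_prop) fun y => Or.inl (by positivity)
  have hgc : Continuous (gradient η) :=
    (InnerProductSpace.toDual ℝ E).symm.continuous.comp (hη.continuous_fderiv one_ne_zero)
  obtain ⟨B, hB, hb⟩ := Continuous.exists_norm_le_of_eLpNorm_top_lt (hcont.smul hgc) hgrad
  refine ⟨2 ^ K * B, by positivity, fun u v huv => ?_⟩
  have hfd : ∀ w ∈ segment ℝ u v, ‖fderiv ℝ η w‖ ≤ 2 ^ K * B * (1 + ‖u‖) ^ (-K) := by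
    intro w hw
    have h1 : ‖(1 + ‖w‖) ^ K • gradient η w‖ ≤ B := hb w
    have h2 : ‖gradient η w‖ = ‖fderiv ℝ η w‖ := LinearIsometryEquiv.norm_map _ _
    rw [norm_smul, h2, Real.norm_of_nonneg (by positivity)] at h1
    have hwu : ‖w - u‖ ≤ 1 := by
      have := norm_sub_le_of_mem_segment hw
      linarith
    have h3 : 1 + ‖u‖ ≤ 2 * (1 + ‖w‖) := by
      have := norm_sub_norm_le u w
      rw [norm_sub_rev] at this
      linarith [norm_nonneg w]
    have h4 : (1 + ‖u‖) ^ K ≤ 2 ^ K * (1 + ‖w‖) ^ K := by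
      rw [← Real.mul_rpow (by norm_num) (by positivity)]
      exact Real.rpow_le_rpow (by positivity) h3 hK.le
    rw [Real.rpow_neg (by positivity), ← div_eq_mul_inv, le_div_iff₀ (by positivity)]
    calc _ ≤ ‖fderiv ℝ η w‖ * (2 ^ K * (1 + ‖w‖) ^ K) := by gcongr
      _ = 2 ^ K * ((1 + ‖w‖) ^ K * ‖fderiv ℝ η w‖) := by ring
      _ ≤ 2 ^ K * B := by gcongr
  have := (convex_segment u v).norm_image_sub_le_of_norm_fderiv_le
    (fun w _ => (hη.differentiable one_ne_zero) w) hfd (left_mem_segment ℝ u v)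
    (right_mem_segment ℝ u v)
  rw [Real.norm_eq_abs] at this
  linarith

end

/-! ### The approximate partition of unity -/

theorem mainTheorem3 {n : ℕ} {ι : Type*}
    (η : EuclideanSpace ℝ (Fin n) → ℝ) (hη : ContDiff ℝ 1 η)
    (x : ι → EuclideanSpace ℝ (Fin n)) (h : ι → ℝ) (hh : ∀ j, 0 < h j)
    (K : ℝ) (hK : 0 < K)
    (hnodes : eLpNorm (nodeSum x h K) ⊤ volume < ⊤)
    (p : ℝ) (hp : 0 < p)
    (hdecay : eLpNorm (fun y => (1 + ‖y‖) ^ K * Real.exp (p ^ 2 * ‖y‖ ^ 2) * η y) ⊤ volume < ⊤)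
    (hgrad : eLpNorm (fun y => (1 + ‖y‖) ^ K • gradient η y) ⊤ volume < ⊤)
    (C : ℝ) (hC : 1 ≤ C) (hratio : ∀ j m, h j / h m ≤ C)
    (c : ℝ) (hc : 0 < c) (hlow : ∀ y, c ≤ ∑' j, scaledTranslate η x h j y) :
    ∀ ε : ℝ, 0 < ε → ∃ (L : ℕ) (P : ι → MvPolynomial (Fin n) ℝ),
      (∀ j, (P j).totalDegree ≤ L) ∧
      ∀ y : EuclideanSpace ℝ (Fin n),
        Summable (fun j => MvPolynomial.eval (fun i => y i) (P j) * scaledTranslate η x h j y) ∧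
        |(∑' j, MvPolynomial.eval (fun i => y i) (P j) * scaledTranslate η x h j y) - 1| < ε := by
  intro ε hε
  obtain ⟨M, hM, hnode⟩ := exists_sum_nodeTerm_le hh hnodes
  obtain ⟨A, hA, hηA⟩ := exists_abs_le_of_decay hη.continuous hdecay
  obtain ⟨D, hD, hηD⟩ := exists_abs_sub_le_of_gradient_decay hη hK hgrad
  have hC0 : 0 < C := by linarith
  have hterm : ∀ j y, (1 + ‖(h j)⁻¹ • (y - x j)‖) ^ (-K) = nodeTerm (x j) (h j) K y := by
    intro j y
    rw [nodeTerm, norm_smul, Real.norm_of_nonneg (inv_pos.2 (hh j)).le]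
  have hbound : ∀ j y, |scaledTranslate η x h j y|
      ≤ A * nodeTerm (x j) (h j) K y * gaussianWeight (p ^ 2) ((h j)⁻¹ • (y - x j)) := by
    intro j y
    rw [← hterm]
    exact hηA _
  have hsumη : ∀ y, Summable fun j => scaledTranslate η x h j y := by
    intro y
    refine .of_norm_bounded ((hnode y).1.mul_left A) fun j => (hbound j y).trans ?_
    exact mul_le_of_le_one_right (mul_nonneg hA.le (nodeTerm_nonneg (hh j) K y))
      (gaussianWeight_le_one (by positivity) _)
  set σ : EuclideanSpace ℝ (Fin n) → ℝ := fun y => ∑' j, scaledTranslate η x h j y with hσ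
  have hσ0 : ∀ y, 0 < σ y := fun y => hc.trans_le (hlow y)
  -- The sum is Lipschitz at the common scale of the nodes.
  have hσlip : ∀ (τ : ℝ) (y z), τ ≤ 1 → (∀ m, (h m)⁻¹ * ‖z - y‖ ≤ τ) →
      |σ z - σ y| ≤ D * τ * M := by
    intro τ y z hτ hyz
    obtain ⟨j₀⟩ : Nonempty ι := by
      by_contra hne
      rw [not_nonempty_iff] at hne
      have := hlow y
      rw [tsum_empty] at this
      linarith
    have hτ0 : 0 ≤ τ := le_trans (by have := hh j₀; positivity) (hyz j₀)
    rw [hσ]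
    dsimp only
    rw [← (hsumη z).tsum_sub (hsumη y)]
    have hle : ∀ m, ‖scaledTranslate η x h m z - scaledTranslate η x h m y‖
        ≤ D * τ * nodeTerm (x m) (h m) K y := by
      intro m
      have hn : ‖(h m)⁻¹ • (z - x m) - (h m)⁻¹ • (y - x m)‖ = (h m)⁻¹ * ‖z - y‖ := by
        rw [← smul_sub, sub_sub_sub_cancel_right, norm_smul,
          Real.norm_of_nonneg (inv_pos.2 (hh m)).le]
      refine (hηD _ _ (hn.trans_le ((hyz m).trans hτ))).trans ?_
      rw [hn, hterm]
      have := nodeTerm_nonneg (x := x m) (hh m) K y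
      gcongr
      exact hyz m
    refine (tsum_of_norm_bounded ((hnode y).1.hasSum.mul_left _) hle).trans ?_
    gcongr
    exact (hnode y).2
  -- The final error is at most `2 δ A M = ε / 2`.
  -- The radius `r` is chosen so that `C r`, the relative size of a step at every other node, is at
  -- most one and changes `1 / σ` by at most `δ`.
  set δ : ℝ := ε / (4 * A * M) with hδdef
  have hδ : 0 < δ := by positivity
  set r : ℝ := min C⁻¹ (δ * c ^ 2 / (D * C * M)) with hr
  have hr0 : 0 < r := by positivity
  have hCr : C * r ≤ 1 := by
    calc C * r ≤ C * C⁻¹ := by gcongr; exact min_le_left _ _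
      _ = 1 := mul_inv_cancel₀ hC0.ne'
  have hDr : D * (C * r) * M ≤ δ * c ^ 2 := by
    have : r ≤ δ * c ^ 2 / (D * C * M) := min_le_right _ _
    rw [le_div_iff₀ (by positivity)] at this
    linarith
  obtain ⟨L, hL⟩ := exists_degree_forall_gaussian_approx (n := n) (s := p ^ 2) (B := c⁻¹)
    (by positivity) (inv_pos.2 hc) hδ hr0
  have hQ : ∀ j, ∃ Q : MvPolynomial (Fin n) ℝ, Q.totalDegree ≤ L ∧
      ∀ u : EuclideanSpace ℝ (Fin n), |(σ (x j + h j • u))⁻¹ - MvPolynomial.eval (fun i => u i) Q|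
        * gaussianWeight (p ^ 2) u ≤ 2 * δ := by
    intro j
    refine hL _ (fun u => ?_) fun u v huv => ?_
    · rw [abs_of_pos (inv_pos.2 (hσ0 _))]
      exact inv_anti₀ hc (hlow _)
    · set y := x j + h j • u with hy
      set z := x j + h j • v with hz
      have hscale : ∀ m, (h m)⁻¹ * ‖z - y‖ ≤ C * r := by
        intro m
        rw [hy, hz, add_sub_add_left_eq_sub, ← smul_sub, norm_smul, norm_sub_rev,
          Real.norm_of_nonneg (hh j).le, ← mul_assoc, inv_mul_eq_div]
        gcongr
        exact hratio j m
      have h1 := (hσlip _ y z hCr hscale).trans hDr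
      rw [inv_sub_inv (hσ0 y).ne' (hσ0 z).ne', abs_div, abs_of_pos (mul_pos (hσ0 y) (hσ0 z)),
        div_le_iff₀ (mul_pos (hσ0 y) (hσ0 z))]
      refine h1.trans ?_
      rw [sq]
      gcongr
      · exact (hσ0 y).le
      · exact hlow y
      · exact hlow z
  choose Q hQdeg hQ using hQ
  choose P hPdeg hP using fun j => exists_totalDegree_le_eval_affine (Q j) (x j) (h j)
  refine ⟨L, P, fun j => (hPdeg j).trans (hQdeg j), fun y => ?_⟩
  have herr : ∀ j, ‖(MvPolynomial.eval (fun i => y i) (P j) - (σ y)⁻¹) * scaledTranslate η x h j y‖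
      ≤ 2 * δ * A * nodeTerm (x j) (h j) K y := by
    intro j
    set u := (h j)⁻¹ • (y - x j) with hu
    have hyu : x j + h j • u = y := by
      rw [hu, smul_inv_smul₀ (hh j).ne', add_sub_cancel]
    have h1 := hQ j u
    rw [hyu, ← hP, abs_sub_comm] at h1
    have h2 := hbound j y
    rw [norm_mul, Real.norm_eq_abs, Real.norm_eq_abs]
    have := nodeTerm_nonneg (x := x j) (hh j) K y
    calc _ ≤ |MvPolynomial.eval (fun i => y i) (P j) - (σ y)⁻¹|
          * (A * nodeTerm (x j) (h j) K y * gaussianWeight (p ^ 2) u) := by gcongr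
      _ = (|MvPolynomial.eval (fun i => y i) (P j) - (σ y)⁻¹| * gaussianWeight (p ^ 2) u)
          * (A * nodeTerm (x j) (h j) K y) := by ring
      _ ≤ 2 * δ * (A * nodeTerm (x j) (h j) K y) := by gcongr
      _ = _ := by ring
  have hmaj := (hnode y).1.mul_left (2 * δ * A)
  have hdiff := Summable.of_norm_bounded hmaj herr
  have hone := (hsumη y).mul_left (σ y)⁻¹
  have hsum : Summable fun j =>
      MvPolynomial.eval (fun i => y i) (P j) * scaledTranslate η x h j y :=
    (hdiff.add hone).congr fun j => by ring
  refine ⟨hsum, ?_⟩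
  have hσ1 : ∑' j, (σ y)⁻¹ * scaledTranslate η x h j y = 1 := by
    rw [tsum_mul_left]
    exact inv_mul_cancel₀ (hσ0 y).ne'
  rw [← hσ1, ← hsum.tsum_sub hone]
  simp_rw [← sub_mul]
  calc _ ≤ 2 * δ * A * ∑' j, nodeTerm (x j) (h j) K y :=
        tsum_of_norm_bounded ((hnode y).1.hasSum.mul_left _) herr
    _ ≤ 2 * δ * A * M := by gcongr; exact (hnode y).2
    _ = ε / 2 := by
        rw [hδdef]
        field_simp
        norm_num
    _ < ε := half_lt_self hε
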